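/- Let $Mx=c$ be an $m\times n$ linear system over $\mathbb Z_2$. Its solution group $\Gamma_{Mx=c}$ is the group generated by $x_1,\dots,x_n,J$ subject to the relations: $[x_i,J]=x_i^2=J^2=1$ for all $i$; $\prod_j x_j^{M_{ij}}=J^{c_i}$ for every row $i$; and $[x_j,x_k]=1$ whenever $M_{ij},M_{ik}\neq 0$ for some row $i$. Wagon wheel system of a presentation. Let $S$ be a finite set with a distinguished element $J\in S$, and let $R$ be a finite set of elements of the free group $\mathcal F(S)$ such that every $r\in R$ that contains $J$ has the form $r=J\cdot w$ with $w\in\mathcal F(S\setminus\{J\})$. (1) Put $S'=\{u_s,v_s : s\in S\setminus\{J\}\}$, and let $\phi_1:\mathcal F(S)\to\mathcal F(S'\cup\{J\})$ be the homomorphism with $\phi_1(s)=u_sv_su_sv_s$ for $s\ne J$ and $\phi_1(J)=J$. For an element $x$ of a free group with reduced word $t_1^{e_1}\cdots t_k^{e_k}$ ($e_i\in\{\pm1\}$), let $x^+=t_1\cdots t_k$. Let $R'=\{\phi_1(r)^+ : r\in R\}$. (2) Write each $r\in R'$ as $r=J^{p}s_1\cdots s_k$ with $p\in\{0,1\}$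 and $s_1,\dots,s_k\in S'$. The variables of the wagon wheel system are the elements of $S'$, shared by all $r\in R'$, and, for each $r\in R'$, separate ancillary variables $a_i,b_i,c_i,d_i$ for $1\le i\le k$. Its equations are, for each $r\in R'$ and $1\le i\le k$, with indices of ancillary variables taken cyclically modulo $k$, $$s_i+a_i+b_i=\begin{cases}p & i=1\\ 0& i\neq 1\end{cases},\qquad b_i+a_{i+1}+c_i=0,\qquad c_i+d_i+d_{i+1}=0 .$$ **Lemma.** Let $Mx=c$ be the wagon wheel system of such a pair $(S,R)$, with its $m$ equations and its $n$ variables numbered in any order. Then in $\Gamma_{Mx=c}$ we have $x_i\neq 1$ and $x_i\ne J$ for all $1\le i\le n$, and $x_ix_j\neq 1$ and $x_ix_j\neq J$ for all $1\le i\neq j\le n$. -/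

import Mathlib

/-! ### Linear systems over `ℤ/2` and their solution groups -/

/-- The relators of the solution group of the `m × n` system `M x = c` over `ℤ/2`, as elements of
the free group on `x₁, …, xₙ, J`. The letter `some j` is `x_j` and the letter `none` is `J`. -/
inductive SolutionRelator {m n : ℕ} (M : Matrix (Fin m) (Fin n) (ZMod 2)) (c : Fin m → ZMod 2) :
    FreeGroup (Option (Fin n)) → Prop
  | comm_J (j : Fin n) : SolutionRelator M c
      (FreeGroup.of (some j) * FreeGroup.of none *
        (FreeGroup.of (some j))⁻¹ * (FreeGroup.of none)⁻¹)
  | sq_x (j : Fin n) : SolutionRelator M c (FreeGroup.of (some j) ^ 2)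
  | sq_J : SolutionRelator M c (FreeGroup.of none ^ 2)
  /-- The `i`-th equation `∏_j x_j ^ M_ij = J ^ c_i`, the product being taken in the order
  `j = 1, …, n`. -/
  | equation (i : Fin m) :
      SolutionRelator M c
        ((List.ofFn fun j : Fin n => FreeGroup.of (some j) ^ (M i j).val).prod *
          (FreeGroup.of none ^ (c i).val)⁻¹)
  | comm_x (i : Fin m) (j k : Fin n) (hj : M i j ≠ 0) (hk : M i k ≠ 0) :
      SolutionRelator M c
        (FreeGroup.of (some j) * FreeGroup.of (some k) *
          (FreeGroup.of (some j))⁻¹ * (FreeGroup.of (some k))⁻¹)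

/-- The solution group of the `m × n` linear system `M x = c` over `ℤ/2`. -/
abbrev SolutionGroup {m n : ℕ} (M : Matrix (Fin m) (Fin n) (ZMod 2)) (c : Fin m → ZMod 2) : Type :=
  PresentedGroup {w | SolutionRelator M c w}

/-- The generator `x_j` of the solution group. -/
def SolutionGroup.x {m n : ℕ} (M : Matrix (Fin m) (Fin n) (ZMod 2)) (c : Fin m → ZMod 2)
    (j : Fin n) : SolutionGroup M c :=
  PresentedGroup.of (some j)

/-- The generator `J` of the solution group. -/
def SolutionGroup.J {m n : ℕ} (M : Matrix (Fin m) (Fin n) (ZMod 2)) (c : Fin m → ZMod 2) :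
    SolutionGroup M c :=
  PresentedGroup.of none

/-! ### First step: doubling the generators

A presentation `⟨S : R⟩` with a distinguished generator `J ∈ S` is given by the type
`T = S \ {J}`, so that `S = Option T` with `J = none`, and a finite set `R` of elements of the
free group on `S`. -/

/-- Every relation that contains `J` has the form `J · w` with `w` a word not containing `J`. -/
def RelatorsNormalized {T : Type*} (R : Finset (FreeGroup (Option T))) : Prop :=
  ∀ r ∈ R, ∃ w : FreeGroup T,
    r = FreeGroup.map some w ∨ r = FreeGroup.of none * FreeGroup.map some w

/-- The homomorphism with `s ↦ u_s v_s u_s v_s` for `s ∈ S \ {J}`, and `J ↦ J`. The new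
generators are `u_s = Sum.inl s` and `v_s = Sum.inr s`. -/
def doubling {T : Type*} : FreeGroup (Option T) →* FreeGroup (Option (T ⊕ T)) :=
  FreeGroup.lift fun
    | none => FreeGroup.of none
    | some s =>
        FreeGroup.of (some (Sum.inl s)) * FreeGroup.of (some (Sum.inr s)) *
          FreeGroup.of (some (Sum.inl s)) * FreeGroup.of (some (Sum.inr s))

/-- The word `x⁺ = s₁ ⋯ s_k`, where `s₁^{a₁} ⋯ s_k^{a_k}` with `a_i ∈ {±1}` is the reduced word
of `x`. -/
def positiveWord {A : Type*} [DecidableEq A] (x : FreeGroup A) : List A :=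
  x.toWord.map Prod.fst

/-- The set `R' = {φ₁(r)⁺ : r ∈ R}` of words over `{u_s, v_s : s ∈ S \ {J}} ∪ {J}`, where `φ₁` is
the homomorphism `doubling`. -/
def doubledRelators {T : Type*} [DecidableEq T] (R : Finset (FreeGroup (Option T))) :
    Finset (List (Option (T ⊕ T))) :=
  R.image fun r => positiveWord (doubling r)

/-! ### Second step: the wagon wheel system

For a word `r = J^p s₁ ⋯ s_k`, the exponent `p` is `wheelParity r` and the list `s₁, …, s_k` of
letters different from `J` is `spokes r`. Indices are counted from `0` instead of `1`. -/

/-- The list of the letters of `r` which are different from `J`. -/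
def spokes {A : Type*} (r : List (Option A)) : List A := r.reduceOption

/-- The exponent `p ∈ ℤ/2` of `J` in `r`. -/
def wheelParity {A : Type*} [DecidableEq A] (r : List (Option A)) : ZMod 2 := (r.count none : ℕ)

/-- The cyclic successor on `Fin k`. -/
def cyclicSucc {k : ℕ} (i : Fin k) : Fin k := ⟨(i.val + 1) % k, Nat.mod_lt _ i.pos⟩

/-- The variables of the wagon wheel system (the hyperedges): the letters in `A`, which are shared
by all wheels, and ancillary variables `a_i, b_i, c_i, d_i` for each relation `r`. -/
inductive WheelVariable {A : Type*} (R' : Finset (List (Option A)))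
  | shared (s : A)
  | a (r : {r // r ∈ R'}) (i : Fin (spokes r.val).length)
  | b (r : {r // r ∈ R'}) (i : Fin (spokes r.val).length)
  | c (r : {r // r ∈ R'}) (i : Fin (spokes r.val).length)
  | d (r : {r // r ∈ R'}) (i : Fin (spokes r.val).length)

/-- The equations of the wagon wheel system (the vertices): for each relation `r`, there are
`2 |r|` vertices on the outer cycle, alternately of type `spoke` (where the hyperedge `s_i` is
attached) and of type `outer`, and `|r|` vertices on the inner cycle. -/
inductive WheelEquation {A : Type*} (R' : Finset (List (Option A)))
  | spoke (r : {r // r ∈ R'}) (i : Fin (spokes r.val).length)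
  | outer (r : {r // r ∈ R'}) (i : Fin (spokes r.val).length)
  | inner (r : {r // r ∈ R'}) (i : Fin (spokes r.val).length)

/-- The hyperedges incident with a vertex. With cyclic indices, they are `s_i, a_i, b_i` at the
`i`-th spoke vertex, `b_i, a_{i+1}, c_i` at the `i`-th remaining outer vertex, and
`c_i, d_i, d_{i+1}` at the `i`-th inner vertex. -/
def incidentVariables {A : Type*} {R' : Finset (List (Option A))} :
    WheelEquation R' → Set (WheelVariable R')
  | .spoke r i => {.shared ((spokes r.val).get i), .a r i, .b r i}
  | .outer r i => {.b r i, .a r (cyclicSucc i), .c r i}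
  | .inner r i => {.c r i, .d r i, .d r (cyclicSucc i)}

open Classical in
/-- The coefficient matrix of the wagon wheel system: the incidence matrix of the hypergraph. -/
noncomputable def wheelMatrix {A : Type*} (R' : Finset (List (Option A))) :
    Matrix (WheelEquation R') (WheelVariable R') (ZMod 2) :=
  fun v e => if e ∈ incidentVariables v then 1 else 0

/-- The right-hand side of the wagon wheel system (the colouring of the vertices): the vertex at
`s₁` in the wheel of `r = J^p s₁ ⋯ s_k` has colour `p`, and all other vertices have colour `0`. -/
def wheelColour {A : Type*} [DecidableEq A] {R' : Finset (List (Option A))} :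
    WheelEquation R' → ZMod 2
  | .spoke r i => if i.val = 0 then wheelParity r.val else 0
  | .outer _ _ => 0
  | .inner _ _ => 0

/-! Since sending `J` to 1 makes the right-hand side disappear, every solution `y` of the
homogeneous system `M y = 0` gives a character of the solution group with values in `ℤ/2`. If `y_i ≠
0`, this character separates `x_i` from both 1 and `J`; if `y_i ≠ y_j`, it does the same for `x_i
x_j`. So it suffices that homogeneous solutions separate the variables from zero and from each
other.

Such solutions are plentiful because doubling makes every letter occur an even number of times in
each relator: any values on the letters sum to zero around each wheel (`sum_map_spokes_doubling`)
and so extend to a solution (`isWheelSolution_wheelAssignment`). The number of spokes is a multiple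
of 4, which excludes degenerate small wheels. Four families of solutions then suffice
(`exists_isWheelSolution_apply_ne`). -/

/-- A classical solution of the homogeneous system `M x = 0` defines a character of the solution
group that kills `J`. -/
theorem SolutionGroup.exists_character {m n : ℕ} (M : Matrix (Fin m) (Fin n) (ZMod 2))
    (c : Fin m → ZMod 2) (y : Fin n → ZMod 2) (hy : ∀ i, ∑ j, M i j * y j = 0) :
    ∃ f : SolutionGroup M c →* Multiplicative (ZMod 2),
      (∀ j, f (SolutionGroup.x M c j) = Multiplicative.ofAdd (y j)) ∧
        f (SolutionGroup.J M c) = 1 := by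
  have two : ∀ a : ZMod 2, a + a = 0 := by decide
  let g : Option (Fin n) → Multiplicative (ZMod 2) :=
    fun o => o.elim 1 fun j => Multiplicative.ofAdd (y j)
  have hg : ∀ w ∈ {w | SolutionRelator M c w}, FreeGroup.lift g w = 1 := by
    rintro w (j | j | _ | i | ⟨i, j, k, hj, hk⟩)
    · simp [g]
    · rw [map_pow, FreeGroup.lift_apply_of, pow_two]
      exact congrArg Multiplicative.ofAdd (two (y j))
    · simp [g]
    · have : ∀ j, Multiplicative.ofAdd (y j) ^ (M i j).val =
          Multiplicative.ofAdd (M i j * y j) := by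
        intro j
        rw [← ofAdd_nsmul, nsmul_eq_mul, ZMod.natCast_zmod_val]
      simp only [map_mul, map_inv, map_pow, FreeGroup.lift_apply_of, map_list_prod, g, Option.elim,
        one_pow, inv_one, mul_one, List.map_ofFn, List.prod_ofFn, Function.comp_def, this,
        ← ofAdd_sum, hy]
      rfl
    · simp [g]
  exact ⟨PresentedGroup.toGroup hg, fun j => PresentedGroup.toGroup.of hg,
    PresentedGroup.toGroup.of hg⟩

/-! ### Classical solutions of the wagon wheel system -/

theorem val_cyclicSucc_of_lt {k : ℕ} (i : Fin k) (h : i.val + 1 < k) :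
    (cyclicSucc i).val = i.val + 1 :=
  Nat.mod_eq_of_lt h

theorem cyclicSucc_ne {k : ℕ} (hk : 2 ≤ k) (i : Fin k) : cyclicSucc i ≠ i := by
  intro h
  have h' : (i.val + 1) % k = i.val := congrArg Fin.val h
  by_cases hi : i.val + 1 < k
  · rw [Nat.mod_eq_of_lt hi] at h'
    omega
  · have : i.val + 1 = k := by omega
    rw [this, Nat.mod_self] at h'
    omega

/-- The sum of the values of `f` at the indices before `i`. -/
def prefixSum {k : ℕ} (f : Fin k → ZMod 2) (i : Fin k) : ZMod 2 := ∑ j ∈ Finset.Iio i, f j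

/-- The recursion is automatic except at the wrap-around, where the full sum must equal the empty
one. -/
theorem prefixSum_cyclicSucc {k : ℕ} (f : Fin k → ZMod 2) (hf : ∑ j, f j = 0) (i : Fin k) :
    prefixSum f (cyclicSucc i) = prefixSum f i + f i := by
  have key : prefixSum f i + f i = ∑ j ∈ Finset.Iic i, f j := by
    have : Finset.Iic i = insert i (Finset.Iio i) := by
      ext j
      simp [le_iff_eq_or_lt]
    rw [prefixSum, this, Finset.sum_insert (by simp), add_comm]
  rw [key, prefixSum]
  by_cases hi : i.val + 1 < k
  · congr 1
    ext j
    simp only [Finset.mem_Iio, Finset.mem_Iic, Fin.lt_def, Fin.le_def, val_cyclicSucc_of_lt i hi]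
    omega
  · have hk : i.val + 1 = k := by omega
    have h0 : (cyclicSucc i).val = 0 := by simp [cyclicSucc, hk]
    have h1 : Finset.Iio (cyclicSucc i) = ∅ := by
      ext j
      simp [Fin.lt_def, h0]
    have h2 : Finset.Iic i = Finset.univ := by
      ext j
      simp only [Finset.mem_Iic, Fin.le_def, Finset.mem_univ, iff_true]
      omega
    rw [h1, h2, hf, Finset.sum_empty]

/-- The indicator function of `{p, q}` for `p ≠ q`, and zero for `p = q`. -/
def pairIndicator {k : ℕ} (p q : Fin k) (i : Fin k) : ZMod 2 :=
  (if i = p then 1 else 0) + (if i = q then 1 else 0)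

theorem sum_pairIndicator {k : ℕ} (p q : Fin k) : ∑ i, pairIndicator p q i = 0 := by
  simp only [pairIndicator, Finset.sum_add_distrib, Finset.sum_ite_eq', Finset.mem_univ, if_true]
  decide

theorem prefixSum_pairIndicator {k : ℕ} (p q i : Fin k) :
    prefixSum (pairIndicator p q) i = (if p < i then 1 else 0) + (if q < i then 1 else 0) := by
  simp [prefixSum, pairIndicator, Finset.sum_add_distrib]

section Wheels

variable {A : Type*} {R' : Finset (List (Option A))}

/-- The assignment with values `σ` on the letters, `γ` on the variables `c`, and `α`, `δ` on the
first of the variables `a`, `d` in each wheel; the other values are forced by the homogeneous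
equations. -/
def wheelAssignment (σ : A → ZMod 2) (α δ : {r // r ∈ R'} → ZMod 2)
    (γ : (r : {r // r ∈ R'}) → Fin (spokes r.val).length → ZMod 2) : WheelVariable R' → ZMod 2
  | .shared s => σ s
  | .a r i => α r + prefixSum (fun j => σ ((spokes r.val).get j) + γ r j) i
  | .b r i => α r + prefixSum (fun j => σ ((spokes r.val).get j) + γ r j) i +
      σ ((spokes r.val).get i)
  | .c r i => γ r i
  | .d r i => δ r + prefixSum (γ r) i

/-- `y` solves the homogeneous wagon wheel system. -/
structure IsWheelSolution (y : WheelVariable R' → ZMod 2) : Prop where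
  spoke (r : {r // r ∈ R'}) (i : Fin (spokes r.val).length) :
    y (.shared ((spokes r.val).get i)) + y (.a r i) + y (.b r i) = 0
  outer (r : {r // r ∈ R'}) (i : Fin (spokes r.val).length) :
    y (.b r i) + y (.a r (cyclicSucc i)) + y (.c r i) = 0
  inner (r : {r // r ∈ R'}) (i : Fin (spokes r.val).length) :
    y (.c r i) + y (.d r i) + y (.d r (cyclicSucc i)) = 0

/-- The equations give `b_i = a_i + s_i`, `a_{i+1} = a_i + s_i + c_i` and `d_{i+1} = d_i + c_i`.
These recursions close up around the wheel because both the `c_i` and the `s_i` sum to zero. -/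
theorem isWheelSolution_wheelAssignment
    (hsum : ∀ r ∈ R', ∀ σ : A → ZMod 2, ((spokes r).map σ).sum = 0)
    (σ : A → ZMod 2) (α δ : {r // r ∈ R'} → ZMod 2)
    (γ : (r : {r // r ∈ R'}) → Fin (spokes r.val).length → ZMod 2) (hγ : ∀ r, ∑ i, γ r i = 0) :
    IsWheelSolution (wheelAssignment σ α δ γ) := by
  have two : ∀ a : ZMod 2, a + a = 0 := by decide
  refine ⟨fun r i => ?_, fun r i => ?_, fun r i => ?_⟩
  · simp only [wheelAssignment]
    generalize σ _ = u, α r + _ = v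
    revert u v
    decide
  · have hs : ∑ j, (σ ((spokes r.val).get j) + γ r j) = 0 := by
      rw [Finset.sum_add_distrib, hγ, add_zero, ← hsum r.val r.2 σ, ← List.sum_ofFn]
      congr 1
      exact List.ext_get (by simp) (by simp)
    simp only [wheelAssignment]
    rw [prefixSum_cyclicSucc _ hs]
    generalize σ _ = u, α r = v, prefixSum _ _ = w, γ r i = x
    revert u v w x
    decide
  · simp only [wheelAssignment]
    rw [prefixSum_cyclicSucc _ (hγ r)]
    generalize δ r = v, prefixSum _ _ = w, γ r i = x
    revert v w x
    decide

open Classical in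
theorem sum_ite_mem_triple {E : Type*} [Fintype E] (x y z : E) (hxy : x ≠ y) (hxz : x ≠ z)
    (hyz : y ≠ z) {s : Set E} (hs : s = {x, y, z}) (f : E → ZMod 2) :
    ∑ e, (if e ∈ s then 1 else 0) * f e = f x + f y + f z := by
  have : (Finset.univ.filter fun e => e ∈ s) = {x, y, z} := by
    ext e
    simp [hs]
  simp only [ite_mul, one_mul, zero_mul]
  rw [← Finset.sum_filter, this, Finset.sum_insert (by simp [hxy, hxz]),
    Finset.sum_insert (by simp [hyz]), Finset.sum_singleton, add_assoc]

theorem IsWheelSolution.sum_wheelMatrix_mul [Fintype (WheelVariable R')]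
    (hlen : ∀ r ∈ R', 0 < (spokes r).length → 3 ≤ (spokes r).length)
    {y : WheelVariable R' → ZMod 2} (hy : IsWheelSolution y) (v : WheelEquation R') :
    ∑ e, wheelMatrix R' v e * y e = 0 := by
  unfold wheelMatrix
  rcases v with ⟨r, i⟩ | ⟨r, i⟩ | ⟨r, i⟩
  · exact (sum_ite_mem_triple _ _ _ (by simp) (by simp) (by simp) rfl y).trans (hy.spoke r i)
  · exact (sum_ite_mem_triple _ _ _ (by simp) (by simp) (by simp) rfl y).trans (hy.outer r i)
  -- With a single spoke, `d_i` and `d_{i+1}` would coincide and the incidence row would no longer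
  -- match the equation.
  · have hi : i ≠ cyclicSucc i :=
      (cyclicSucc_ne (by have := hlen r.val r.2 i.pos; omega) i).symm
    exact (sum_ite_mem_triple _ _ _ (by simp) (by simp) (by simpa using hi) rfl y).trans
      (hy.inner r i)

/-! ### Four families of homogeneous solutions -/

open Classical in
/-- The indicator function of a letter, extended to a homogeneous solution. -/
noncomputable def letterSolution (s : A) : WheelVariable R' → ZMod 2 :=
  wheelAssignment (Pi.single s 1) 0 0 0

open Classical in
/-- The solution which is `1` exactly at the variables `a` and `b` of the wheel `r`. -/
noncomputable def rimSolution (r : {r // r ∈ R'}) : WheelVariable R' → ZMod 2 :=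
  wheelAssignment 0 (Pi.single r 1) 0 0

open Classical in
/-- The solution which is `1` exactly at the variables `d` of the wheel `r`. -/
noncomputable def hubSolution (r : {r // r ∈ R'}) : WheelVariable R' → ZMod 2 :=
  wheelAssignment 0 0 (Pi.single r 1) 0

open Classical in
/-- The solution supported on the wheel `r` whose values at the variables `c` are the indicator
function of `{p, q}`. -/
noncomputable def pairSolution (r : {r // r ∈ R'}) (p q : Fin (spokes r.val).length) :
    WheelVariable R' → ZMod 2 :=
  wheelAssignment 0 0 0 (Pi.single r (pairIndicator p q))

theorem isWheelSolution_letterSolution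
    (hsum : ∀ r ∈ R', ∀ σ : A → ZMod 2, ((spokes r).map σ).sum = 0) (s : A) :
    IsWheelSolution (R' := R') (letterSolution s) :=
  isWheelSolution_wheelAssignment hsum _ _ _ _ (by simp)

theorem isWheelSolution_rimSolution
    (hsum : ∀ r ∈ R', ∀ σ : A → ZMod 2, ((spokes r).map σ).sum = 0) (r : {r // r ∈ R'}) :
    IsWheelSolution (rimSolution r) :=
  isWheelSolution_wheelAssignment hsum _ _ _ _ (by simp)

theorem isWheelSolution_hubSolution
    (hsum : ∀ r ∈ R', ∀ σ : A → ZMod 2, ((spokes r).map σ).sum = 0) (r : {r // r ∈ R'}) :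
    IsWheelSolution (hubSolution r) :=
  isWheelSolution_wheelAssignment hsum _ _ _ _ (by simp)

theorem isWheelSolution_pairSolution
    (hsum : ∀ r ∈ R', ∀ σ : A → ZMod 2, ((spokes r).map σ).sum = 0) (r : {r // r ∈ R'})
    (p q : Fin (spokes r.val).length) : IsWheelSolution (pairSolution r p q) := by
  classical
  refine isWheelSolution_wheelAssignment hsum _ _ _ _ fun r' => ?_
  rcases eq_or_ne r' r with rfl | h
  · simpa using sum_pairIndicator p q
  · simp [Pi.single_eq_of_ne h]

/-- On the wheel `r`, the values at `a`, `b` and `d` are all the indicator of `i < l ≤ j`, so this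
solution tells position `i` from position `j`. -/
theorem pairSolution_of_lt (r : {r // r ∈ R'}) {i j : Fin (spokes r.val).length} (h : i < j) :
    pairSolution r i j (.a r i) = 0 ∧ pairSolution r i j (.b r i) = 0 ∧
      pairSolution r i j (.d r i) = 0 ∧ pairSolution r i j (.a r j) = 1 ∧
      pairSolution r i j (.b r j) = 1 ∧ pairSolution r i j (.d r j) = 1 := by
  have h' : ∀ l, prefixSum (fun m => pairIndicator i j m) l = _ := prefixSum_pairIndicator i j
  simp [pairSolution, wheelAssignment, h', h, h.not_gt]

/-! ### Separating the variables -/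

theorem exists_ne_ne {k : ℕ} (hk : 3 ≤ k) (i j : Fin k) : ∃ q, q ≠ i ∧ q ≠ j := by
  obtain ⟨q, hq⟩ := Finset.exists_mem_notMem_of_card_lt_card (s := {i, j}) (t := Finset.univ)
    (lt_of_le_of_lt Finset.card_le_two (by rw [Finset.card_univ, Fintype.card_fin]; omega))
  exact ⟨q, by simpa using hq.2⟩

theorem exists_isWheelSolution_ne_zero
    (hlen : ∀ r ∈ R', 0 < (spokes r).length → 3 ≤ (spokes r).length)
    (hsum : ∀ r ∈ R', ∀ σ : A → ZMod 2, ((spokes r).map σ).sum = 0) (e : WheelVariable R') :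
    ∃ y, IsWheelSolution y ∧ y e ≠ 0 := by
  rcases e with s | ⟨r, i⟩ | ⟨r, i⟩ | ⟨r, i⟩ | ⟨r, i⟩
  · exact ⟨_, isWheelSolution_letterSolution hsum s, by simp [letterSolution, wheelAssignment]⟩
  · exact ⟨_, isWheelSolution_rimSolution hsum r,
      by simp [rimSolution, wheelAssignment, prefixSum]⟩
  · exact ⟨_, isWheelSolution_rimSolution hsum r,
      by simp [rimSolution, wheelAssignment, prefixSum]⟩
  · obtain ⟨q, hq, -⟩ := exists_ne_ne (hlen r.val r.2 i.pos) i i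
    exact ⟨_, isWheelSolution_pairSolution hsum r i q,
      by simp [pairSolution, wheelAssignment, pairIndicator, hq.symm]⟩
  · exact ⟨_, isWheelSolution_hubSolution hsum r,
      by simp [hubSolution, wheelAssignment, prefixSum]⟩

theorem exists_isWheelSolution_apply_ne
    (hlen : ∀ r ∈ R', 0 < (spokes r).length → 3 ≤ (spokes r).length)
    (hsum : ∀ r ∈ R', ∀ σ : A → ZMod 2, ((spokes r).map σ).sum = 0)
    {e e' : WheelVariable R'} (hne : e ≠ e') : ∃ y, IsWheelSolution y ∧ y e ≠ y e' := by
  classical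
  by_contra! h
  have letter s := h _ (isWheelSolution_letterSolution hsum s)
  have rim r := h _ (isWheelSolution_rimSolution hsum r)
  have hub r := h _ (isWheelSolution_hubSolution hsum r)
  have pair r p q := h _ (isWheelSolution_pairSolution hsum r p q)
  have spare (r : {r // r ∈ R'}) (i j : Fin (spokes r.val).length) :=
    exists_ne_ne (hlen r.val r.2 i.pos) i j
  rcases e with s | ⟨r, i⟩ | ⟨r, i⟩ | ⟨r, i⟩ | ⟨r, i⟩ <;>
    rcases e' with s' | ⟨r', i'⟩ | ⟨r', i'⟩ | ⟨r', i'⟩ | ⟨r', i'⟩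
  · have := letter s
    have hs : s' ≠ s := by
      rintro rfl
      exact hne rfl
    simp [letterSolution, wheelAssignment, hs] at this
  -- Rim solutions settle the pairs with exactly one variable of type `a` or `b`; hub solutions then
  -- settle those with exactly one of type `d`. What remains is `c` against a letter, `a` or `b`
  -- against `a` or `b`, `c` against `c`, and `d` against `d`.
  all_goals try
    have := rim r
    simp [rimSolution, wheelAssignment, prefixSum] at this
    done
  all_goals try
    have := rim r'
    simp [rimSolution, wheelAssignment, prefixSum] at this
    done
  all_goals try
    have := hub r
    simp [hubSolution, wheelAssignment, prefixSum] at this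
    done
  all_goals try
    have := hub r'
    simp [hubSolution, wheelAssignment, prefixSum] at this
    done
  · obtain ⟨q, hq, -⟩ := spare r' i' i'
    have := pair r' i' q
    simp [pairSolution, wheelAssignment, pairIndicator, hq.symm] at this
  · obtain rfl : r' = r := by
      by_contra hr
      have := rim r
      simp [rimSolution, wheelAssignment, prefixSum, Pi.single_eq_of_ne hr] at this
    rcases lt_trichotomy i i' with hi | rfl | hi
    · have := pair _ i i'
      simp [pairSolution_of_lt _ hi] at this
    · exact hne rfl
    · have := pair _ i' i
      simp [pairSolution_of_lt _ hi] at this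
  · obtain rfl : r' = r := by
      by_contra hr
      have := rim r
      simp [rimSolution, wheelAssignment, prefixSum, Pi.single_eq_of_ne hr] at this
    rcases lt_trichotomy i i' with hi | rfl | hi
    · have := pair _ i i'
      simp [pairSolution_of_lt _ hi] at this
    -- `a_i` and `b_i` differ by the value of the letter `s_i`, here 1.
    · have := letter ((spokes r'.val).get i)
      simp [letterSolution, wheelAssignment] at this
    · have := pair _ i' i
      simp [pairSolution_of_lt _ hi] at this
  · obtain rfl : r' = r := by
      by_contra hr
      have := rim r
      simp [rimSolution, wheelAssignment, prefixSum, Pi.single_eq_of_ne hr] at this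
    rcases lt_trichotomy i i' with hi | rfl | hi
    · have := pair _ i i'
      simp [pairSolution_of_lt _ hi] at this
    · have := letter ((spokes r'.val).get i)
      simp [letterSolution, wheelAssignment] at this
    · have := pair _ i' i
      simp [pairSolution_of_lt _ hi] at this
  · obtain rfl : r' = r := by
      by_contra hr
      have := rim r
      simp [rimSolution, wheelAssignment, prefixSum, Pi.single_eq_of_ne hr] at this
    rcases lt_trichotomy i i' with hi | rfl | hi
    · have := pair _ i i'
      simp [pairSolution_of_lt _ hi] at this
    · exact hne rfl
    · have := pair _ i' i
      simp [pairSolution_of_lt _ hi] at this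
  · obtain ⟨q, hq, -⟩ := spare r i i
    have := pair r i q
    simp [pairSolution, wheelAssignment, pairIndicator, hq.symm] at this
  · obtain rfl : r' = r := by
      by_contra hr
      obtain ⟨q, hq, -⟩ := spare r i i
      have := pair r i q
      simp [pairSolution, wheelAssignment, pairIndicator, hq.symm, Pi.single_eq_of_ne hr] at this
    -- The second index must avoid `i'` too, or both `c` variables would get the value 1.
    obtain ⟨q, hq, hq'⟩ := spare r' i i'
    have hi : i' ≠ i := by
      rintro rfl
      exact hne rfl
    have := pair r' i q
    simp [pairSolution, wheelAssignment, pairIndicator, hq.symm, hq'.symm, hi] at this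
  · obtain rfl : r' = r := by
      by_contra hr
      have := hub r
      simp [hubSolution, wheelAssignment, prefixSum, Pi.single_eq_of_ne hr] at this
    rcases lt_trichotomy i i' with hi | rfl | hi
    · have := pair _ i i'
      simp [pairSolution_of_lt _ hi] at this
    · exact hne rfl
    · have := pair _ i' i
      simp [pairSolution_of_lt _ hi] at this

end Wheels

/-! ### The words of the doubled relators -/

section Doubling

variable {T : Type*}

/-- The reduced word of the image of a letter or inverse letter under `doubling`. -/
def doubledLetter : Option T × Bool → List (Option (T ⊕ T) × Bool)
  | (none, ε) => [(none, ε)]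
  | (some s, true) => [(some (.inl s), true), (some (.inr s), true),
      (some (.inl s), true), (some (.inr s), true)]
  | (some s, false) => [(some (.inr s), false), (some (.inl s), false),
      (some (.inr s), false), (some (.inl s), false)]

theorem mk_flatMap_doubledLetter (L : List (Option T × Bool)) :
    FreeGroup.mk (L.flatMap doubledLetter) = doubling (FreeGroup.mk L) := by
  induction L with
  | nil => exact (map_one _).symm
  | cons x L ih =>
    have h : FreeGroup.mk (x :: L) = FreeGroup.mk [x] * FreeGroup.mk L := rfl
    rw [List.flatMap_cons, ← FreeGroup.mul_mk, ih, h, map_mul]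
    congr 1
    rcases x with ⟨_ | s, _ | _⟩ <;> rfl

/-- Each block is reduced, and adjacent blocks cancel at their junction only if they come from
mutually inverse letters. -/
theorem isReduced_flatMap_doubledLetter {L : List (Option T × Bool)} (hL : FreeGroup.IsReduced L) :
    FreeGroup.IsReduced (L.flatMap doubledLetter) := by
  rw [FreeGroup.IsReduced, List.flatMap_def, List.isChain_flatten]
  · refine ⟨?_, ?_⟩
    · simp only [List.mem_map, forall_exists_index, and_imp, forall_apply_eq_imp_iff₂]
      rintro ⟨_ | s, _ | _⟩ - <;> simp [doubledLetter]
    · rw [List.isChain_map]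
      refine hL.imp ?_
      rintro ⟨_ | s, _ | _⟩ ⟨_ | t, _ | _⟩ <;> simp [doubledLetter]
  · simp only [List.mem_map, not_exists, not_and]
    rintro ⟨_ | s, _ | _⟩ - <;> simp [doubledLetter]

theorem toWord_doubling [DecidableEq T] (x : FreeGroup (Option T)) :
    (doubling x).toWord = x.toWord.flatMap doubledLetter := by
  rw [← (isReduced_flatMap_doubledLetter FreeGroup.isReduced_toWord).reduce_eq,
    ← FreeGroup.toWord_mk, mk_flatMap_doubledLetter, FreeGroup.mk_toWord]

theorem spokes_append {A : Type*} (l l' : List (Option A)) :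
    spokes (l ++ l') = spokes l ++ spokes l' :=
  List.reduceOption_append l l'

theorem four_dvd_length_spokes_doubling [DecidableEq T] (x : FreeGroup (Option T)) :
    4 ∣ (spokes (positiveWord (doubling x))).length := by
  rw [positiveWord, toWord_doubling]
  induction x.toWord with
  | nil => simp [spokes]
  | cons y L ih =>
    rw [List.flatMap_cons, List.map_append, spokes_append, List.length_append]
    refine dvd_add ?_ ih
    rcases y with ⟨_ | s, _ | _⟩ <;> simp [doubledLetter, spokes]

/-- Whatever the sign of `s`, its block contains `u_s` and `v_s` twice each, contributing zero mod
2. -/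
theorem sum_map_spokes_doubling [DecidableEq T] (x : FreeGroup (Option T)) (σ : T ⊕ T → ZMod 2) :
    ((spokes (positiveWord (doubling x))).map σ).sum = 0 := by
  rw [positiveWord, toWord_doubling]
  induction x.toWord with
  | nil => simp [spokes]
  | cons y L ih =>
    rw [List.flatMap_cons, List.map_append, spokes_append, List.map_append, List.sum_append, ih,
      add_zero]
    rcases y with ⟨_ | s, _ | _⟩ <;> simp only [doubledLetter, spokes, List.map_cons, List.map_nil,
      List.reduceOption_cons_of_some, List.reduceOption_cons_of_none, List.reduceOption_nil,
      List.sum_cons, List.sum_nil]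
    all_goals
      generalize σ (.inl s) = u, σ (.inr s) = v
      revert u v
      decide

end Doubling

/-! ### The lemma -/

theorem lemma4p2 {T : Type*} [Finite T] [DecidableEq T]
    (R : Finset (FreeGroup (Option T))) (hR : RelatorsNormalized R)
    (m n : ℕ)
    (rows : Fin m ≃ WheelEquation (doubledRelators R))
    (cols : Fin n ≃ WheelVariable (doubledRelators R))
    (M : Matrix (Fin m) (Fin n) (ZMod 2))
    (hM : M = (wheelMatrix (doubledRelators R)).submatrix rows cols)
    (c : Fin m → ZMod 2) (hc : c = fun i => wheelColour (rows i)) :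
    (∀ i : Fin n, SolutionGroup.x M c i ≠ 1 ∧
      SolutionGroup.x M c i ≠ SolutionGroup.J M c) ∧
    (∀ i j : Fin n, i ≠ j →
      SolutionGroup.x M c i * SolutionGroup.x M c j ≠ 1 ∧
      SolutionGroup.x M c i * SolutionGroup.x M c j ≠ SolutionGroup.J M c) := by
  have hlen : ∀ r ∈ doubledRelators R, 0 < (spokes r).length → 3 ≤ (spokes r).length := by
    intro r hr hpos
    obtain ⟨x, -, rfl⟩ := Finset.mem_image.mp hr
    have := Nat.le_of_dvd hpos (four_dvd_length_spokes_doubling x)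
    omega
  have hsum : ∀ r ∈ doubledRelators R, ∀ σ : T ⊕ T → ZMod 2, ((spokes r).map σ).sum = 0 := by
    intro r hr σ
    obtain ⟨x, -, rfl⟩ := Finset.mem_image.mp hr
    exact sum_map_spokes_doubling x σ
  have character : ∀ y : WheelVariable (doubledRelators R) → ZMod 2, IsWheelSolution y →
      ∃ f : SolutionGroup M c →* Multiplicative (ZMod 2),
        (∀ j, f (SolutionGroup.x M c j) = Multiplicative.ofAdd (y (cols j))) ∧
          f (SolutionGroup.J M c) = 1 := by
    intro y hy
    let _ : Fintype (WheelVariable (doubledRelators R)) := Fintype.ofEquiv _ cols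
    refine SolutionGroup.exists_character M c (fun j => y (cols j)) fun i => ?_
    subst hM
    exact (cols.sum_comp fun e => wheelMatrix _ (rows i) e * y e).trans
      (hy.sum_wheelMatrix_mul hlen (rows i))
  refine ⟨fun i => ?_, fun i j hij => ?_⟩
  · obtain ⟨y, hy, hi⟩ := exists_isWheelSolution_ne_zero hlen hsum (cols i)
    obtain ⟨f, hx, hJ⟩ := character y hy
    -- As `f` sends both 1 and `J` to 1, one nontrivial value excludes both equalities.
    have key : f (SolutionGroup.x M c i) ≠ 1 := by
      rw [hx]
      exact fun h => hi (ofAdd_eq_one.mp h)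
    exact ⟨fun h => key (by rw [h, map_one]), fun h => key (by rw [h, hJ])⟩
  · obtain ⟨y, hy, hne⟩ := exists_isWheelSolution_apply_ne hlen hsum (cols.injective.ne hij)
    obtain ⟨f, hx, hJ⟩ := character y hy
    have key : f (SolutionGroup.x M c i * SolutionGroup.x M c j) ≠ 1 := by
      rw [map_mul, hx, hx, ← ofAdd_add]
      exact fun h => hne (CharTwo.add_eq_zero.mp (ofAdd_eq_one.mp h))
    exact ⟨fun h => key (by rw [h, map_one]), fun h => key (by rw [h, hJ])⟩
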